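/- Let $G$ be a finite simple graph with vertex set $V$ and adjacency relation $\sim$, whose vertices label qubits, let $I,O\subseteq V$, write $I^c=V\setminus I$, $O^c=V\setminus O$, and let $M_{XY},M_{YZ}\subseteq O^c$ satisfy $M_{XY}\cup M_{YZ}=O^c$. An extended flow for $(G,I,O,M_{XY},M_{YZ})$ is a pair $(f,\preceq)$ of a function $f:O^c\to I^c$ and a partial order $\preceq$ on $V$ such that for all $v\in O^c$ and $w\in V$: $f(v)\sim v$ if $v\in M_{XY}\setminus M_{YZ}$; $f(v)=v$ if $v\in M_{YZ}\setminus M_{XY}$; $f(v)\sim v$ or $f(v)=v$ if $v\in M_{XY}\cap M_{YZ}$; $v\preceq f(v)$; and $w\sim f(v)$ implies $v\preceq w$. For an angle $\theta$ put $|\pm xy_\theta\rangle=\tfrac1{\sqrt2}(|0\rangle\pm e^{i\theta}|1\rangle)$ and $|\pm yz_\theta\rangle=\tfrac12(|0\rangle+|1\rangle)\pm\tfrac{e^{-i\theta}}2(|0\rangle-|1\rangle)$. Let $\mathsf N_{I^c}$ prepare each qubit of $I^c$ in the state $|+\rangle=\tfrac1{\sqrt2}(|0\rangle+|1\rangle)$,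 let $\mathsf E_G$ apply a controlled-$Z$ operation along each edge of $G$, let $\mathsf M^{XY,\theta}_u$ (respectively $\mathsf M^{YZ,\theta}_u$) measure and destroy the qubit $u$ in the basis $|\pm xy_\theta\rangle$ (respectively $|\pm yz_\theta\rangle$), recording the result $s_u=0$ for $+$ and $s_u=1$ for $-$, and let $\mathsf X_v^{s}$, $\mathsf Z_v^{s}$ be conjugation by $X_v^{s}$, $Z_v^{s}$. Suppose $(f,\preceq)$ is an extended flow for $(G,I,O,M_{XY},M_{YZ})$. Let $\lambda:V\to\{XY,YZ\}$ be such that $u\in M_{\lambda(u)}$ for every $u\in O^c$, and let $(\theta_u)_{u\in O^c}$ be real angles such that $\theta_u\in\{\tfrac\pi2,-\tfrac\pi2\}$ for every $u\in M_{XY}\cap M_{YZ}$ (so that such $u$ are measured in the eigenbasis of $Y$). Then for every linear order $\le$ on $V$ extending $\preceq$, the measurement procedure $$\Bigg[\prod_{u\in O^c}^{\le}\Bigg(\prod_{w\sim f(u),\,w\ne u}\mathsf Z_w^{s_u}\Bigg)\Bigg(\prod_{v=f(u),\,v\neq u}\mathsf X_v^{s_u}\Bigg)\mathsf M^{\lambda(u),\theta_u}_u\Bigg]\,\mathsf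 E_G\,\mathsf N_{I^c}$$ (maps are composed from right to left, factors with $\le$-smaller $u$ are performed earlier, and the classical bits $s_u$ are ignored in the output) performs a unitary transformation: there is a linear map $U$ from the state space of the qubits $I$ to the state space of the qubits $O$ with $U^\dagger U=1$, and also $UU^\dagger=1$ when $|I|=|O|$, such that the procedure maps $\rho$ to $U\rho U^\dagger$ for every operator $\rho$ on the state space of $I$. -/

import Mathlib

open scoped Matrix

noncomputable section

namespace OneWay

/-! Systems of qubits. The qubits are labelled by a finite type `V`. The computational basis of the
state space of a set `S` of qubits consists of the functions `S → Fin 2`. -/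

/-- Operators on the state space of the system `S`; density operators are particular elements. -/
abbrev Op {V : Type*} (S : Finset V) : Type _ := Matrix (S → Fin 2) (S → Fin 2) ℂ

/-- States of a quantum system `S` together with a classical bit register holding one bit `s v` for
every label `v`: the family `ρ` stands for `∑ s, ρ s ⊗ |s⟩⟨s|`. -/
abbrev CQ {V : Type*} (S : Finset V) : Type _ := (V → Fin 2) → Op S

/-- The map `ρ ↦ K ρ K†`. -/
def conjBy {m n : Type*} [Fintype n] (K : Matrix m n ℂ) (ρ : Matrix n n ℂ) : Matrix m m ℂ :=
  K * ρ * Kᴴ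

/-- The state `|+⟩ = (|0⟩ + |1⟩) / √2`. -/
def ketPlus : Fin 2 → ℂ := fun _ => 1 / (Real.sqrt 2 : ℂ)

/-- The Pauli operator `X`. -/
def pauliX : Matrix (Fin 2) (Fin 2) ℂ := !![0, 1; 1, 0]

/-- The Pauli operator `Z`. -/
def pauliZ : Matrix (Fin 2) (Fin 2) ℂ := !![1, 0; 0, -1]

/-- The planes in which the qubits may be measured. -/
inductive Plane
  | XY
  | YZ

/-- The measurement basis in a plane, for an angle `θ`; the element with index `0` is the `+` state
and the one with index `1` is the `-` state:
`|±xy_θ⟩ = (|0⟩ ± e^{iθ} |1⟩) / √2`,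
`|±yz_θ⟩ = (|0⟩ + |1⟩) / 2 ± e^{-iθ} (|0⟩ - |1⟩) / 2`. -/
def measKet : Plane → ℝ → Fin 2 → (Fin 2 → ℂ)
  | Plane.XY, θ, b =>
      ![1 / (Real.sqrt 2 : ℂ),
        (-1) ^ (b : ℕ) * Complex.exp (Complex.I * θ) / (Real.sqrt 2 : ℂ)]
  | Plane.YZ, θ, b =>
      ![1 / 2 + (-1) ^ (b : ℕ) * (Complex.exp (-(Complex.I * θ)) / 2),
        1 / 2 - (-1) ^ (b : ℕ) * (Complex.exp (-(Complex.I * θ)) / 2)]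

section Operations

variable {V : Type*} [DecidableEq V]

/-- The operator that acts as `A` on the qubit `v` and as the identity on the other qubits of `S`
(for `v ∉ S`, the identity). -/
def onQubit {S : Finset V} (v : V) (A : Matrix (Fin 2) (Fin 2) ℂ) : Op S :=
  if h : v ∈ S then
    Matrix.of fun x y => if ∀ w : S, w.1 ≠ v → x w = y w then A (x ⟨v, h⟩) (y ⟨v, h⟩) else 0
  else 1

/-- For `S ⊆ T`, the operator `|ψ⟩ ↦ |ψ⟩ ⊗ ⨂_{v ∈ T \ S} |+⟩_v`. -/
def adjoinPlus {S T : Finset V} (h : S ⊆ T) : Matrix (T → Fin 2) (S → Fin 2) ℂ :=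
  Matrix.of fun x y =>
    if (∀ w : S, x ⟨w.1, h w.2⟩ = y w) then ∏ v : T, (if v.1 ∈ S then 1 else ketPlus (x v)) else 0

/-- The operator `⟨φ|_v ⊗ 1` from the system `S` to the system `S \ {v}` (for `v ∉ S`, nothing is
done). -/
def braAt {S : Finset V} (v : V) (φ : Fin 2 → ℂ) :
    Matrix (S.erase v → Fin 2) (S → Fin 2) ℂ :=
  Matrix.of fun x y =>
    if (∀ w : S.erase v, x w = y ⟨w.1, Finset.mem_of_mem_erase w.2⟩) then
      (if h : v ∈ S then star (φ (y ⟨v, h⟩)) else 1)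
    else 0

/-- The controlled-`Z` operator on the two ends of `e`: the basis state `x` gets the sign `-1`
exactly when `x` is `1` on both ends. -/
def czOp {S : Finset V} (e : Sym2 V) : Op S :=
  Matrix.diagonal fun x => open Classical in if (∀ v : S, v.1 ∈ e → x v = 1) then -1 else 1

/-- The initial classical-quantum state: all bits are `0` and the quantum state is `ρ`. -/
def initial {S : Finset V} (ρ : Op S) : CQ S :=
  open Classical in fun s => if s = 0 then ρ else 0

/-- The preparation of all qubits of `T \ S` in the state `|+⟩`. -/
def prepare {S T : Finset V} (h : S ⊆ T) (ρ : CQ S) : CQ T :=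
  fun s => conjBy (adjoinPlus h) (ρ s)

/-- The entangling map for the pair `e`. -/
def entangle {S : Finset V} (e : Sym2 V) (ρ : CQ S) : CQ S :=
  fun s => conjBy (czOp e) (ρ s)

/-- The entangling map of the graph `G`: the composition of the (mutually commuting) entangling maps
for its edges. -/
def entangleGraph [Fintype V] (G : SimpleGraph V) [DecidableRel G.Adj] {S : Finset V}
    (ρ : CQ S) : CQ S :=
  G.edgeFinset.toList.foldr entangle ρ

/-- The destructive measurement of `v` in the plane `p` with angle `θ`. The result is written to the
bit `s v`, whose previous value is discarded. -/
def measure {S : Finset V} (p : Plane) (v : V) (θ : ℝ) (ρ : CQ S) : CQ (S.erase v) :=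
  fun s => conjBy (braAt v (measKet p θ (s v))) (∑ b : Fin 2, ρ (Function.update s v b))

/-- The correction `X_w^{s u}`. -/
def xCorr {S : Finset V} (w u : V) (ρ : CQ S) : CQ S :=
  fun s => conjBy (onQubit w (pauliX ^ (s u : ℕ))) (ρ s)

/-- The correction `Z_w^{s u}`. -/
def zCorr {S : Finset V} (w u : V) (ρ : CQ S) : CQ S :=
  fun s => conjBy (onQubit w (pauliZ ^ (s u : ℕ))) (ρ s)

/-- One factor of the ordered product: `u` is measured, then (when `fu ≠ u`) the correction
`X_{fu}^{s u}` and then, for all neighbours `w ≠ u` of `fu`, the corrections `Z_w^{s u}` are done. -/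
def measureAndCorrect [Fintype V] (G : SimpleGraph V) [DecidableRel G.Adj] {S : Finset V}
    (p : Plane) (u : V) (θ : ℝ) (fu : V) (ρ : CQ S) : CQ (S.erase u) :=
  ((G.neighborFinset fu).erase u).toList.foldr (fun w σ => zCorr w u σ)
    (if fu ≠ u then xCorr fu u (measure p u θ ρ) else measure p u θ ρ)

/-- The system that is left of `S` after the qubits in a list have been measured. -/
def remaining {D : Finset V} : List D → Finset V → Finset V
  | [], S => S
  | u :: l, S => remaining l (S.erase u.1)

/-- The composition of the maps `measureAndCorrect` for the qubits in a list, the head of the list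
being treated first. -/
def runList [Fintype V] (G : SimpleGraph V) [DecidableRel G.Adj] {D : Finset V} (plane : V → Plane)
    (θ : V → ℝ) (f : D → V) : (l : List D) → (S : Finset V) → CQ S → CQ (remaining l S)
  | [], _, ρ => ρ
  | u :: l, S, ρ =>
      runList G plane θ f l (S.erase u.1) (measureAndCorrect G (plane u) u (θ u) (f u) ρ)

theorem mem_remaining {D : Finset V} (l : List D) (S : Finset V) (v : V) :
    v ∈ remaining l S ↔ v ∈ S ∧ ∀ u ∈ l, u.1 ≠ v := by
  induction l generalizing S with
  | nil => simp [remaining]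
  | cons u l ih =>
    simp only [remaining, ih, Finset.mem_erase, List.mem_cons, forall_eq_or_imp]
    constructor
    · rintro ⟨⟨h1, h2⟩, h3⟩
      exact ⟨h2, fun h => h1 h.symm, h3⟩
    · rintro ⟨h1, h2, h3⟩
      exact ⟨⟨fun h => h2 h.symm, h1⟩, h3⟩

/-- Read an operator on a system as an operator on the same system under another name. -/
def castOp {S T : Finset V} (h : S = T) (ρ : Op S) : Op T :=
  ρ.submatrix (fun x v => x ⟨v.1, h ▸ v.2⟩) (fun x v => x ⟨v.1, h ▸ v.2⟩)

end Operations

/-- `(f, prec)` is an extended flow for `(G, I, O, MXY, MYZ)`. -/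
structure IsExtendedFlow {V : Type*} [Fintype V] [DecidableEq V] (G : SimpleGraph V)
    (I O MXY MYZ : Finset V) (f : {v // v ∈ Oᶜ} → {v // v ∈ Iᶜ}) (prec : V → V → Prop) :
    Prop where
  isPartialOrder : IsPartialOrder V prec
  adj_of_xy : ∀ v, v.1 ∈ MXY \ MYZ → G.Adj (f v).1 v.1
  eq_of_yz : ∀ v, v.1 ∈ MYZ \ MXY → (f v).1 = v.1
  adj_or_eq : ∀ v, v.1 ∈ MYZ ∩ MXY → G.Adj (f v).1 v.1 ∨ (f v).1 = v.1
  prec_apply : ∀ v, prec v.1 (f v).1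
  prec_of_adj : ∀ v w, G.Adj w (f v).1 → prec v.1 w

section Procedure

variable {V : Type*} [Fintype V] [LinearOrder V]

/-- The qubits outside `O` in increasing order. -/
def measurementOrder (O : Finset V) : List {v // v ∈ Oᶜ} :=
  (Finset.univ : Finset {v // v ∈ Oᶜ}).sort (· ≤ ·)

theorem remaining_measurementOrder (O : Finset V) :
    remaining (measurementOrder O) Finset.univ = O := by
  ext v
  simp only [mem_remaining, measurementOrder, Finset.mem_sort, Finset.mem_univ, true_and,
    forall_true_left]
  constructor
  · intro h
    by_contra hv
    exact h ⟨v, by simpa using hv⟩ rfl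
  · rintro hv ⟨u, hu⟩ rfl
    simp [hv] at hu

/-- The measurement-based procedure, as a map from operators on the input system `I` to operators on
the output system `O`: prepare the qubits outside `I`, entangle along the edges of `G`, measure the
qubits outside `O` in increasing order, correcting after each measurement, and finally ignore the
classical bits. -/
def procedure (G : SimpleGraph V) [DecidableRel G.Adj] (I O : Finset V)
    (f : {v // v ∈ Oᶜ} → {v // v ∈ Iᶜ}) (plane : V → Plane) (θ : V → ℝ) (ρ : Op I) : Op O :=
  castOp (remaining_measurementOrder O)
    (∑ s, runList G plane θ (fun u => (f u).1) (measurementOrder O) Finset.univ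
      (entangleGraph G (prepare (Finset.subset_univ I) (initial ρ))) s)

end Procedure

/-- The map `Φ` from operators on the system `I` to operators on the system `O` is a unitary
transformation `ρ ↦ U ρ U†`. Here `U` is a unitary embedding of the state space of `I` into that of
`O`, and it is a unitary bijection when the two systems have equally many qubits. -/
def PerformsUnitary {V : Type*} [DecidableEq V] {I O : Finset V} (Φ : Op I → Op O) : Prop :=
  ∃ U : Matrix (O → Fin 2) (I → Fin 2) ℂ,
    Uᴴ * U = 1 ∧ (I.card = O.card → U * Uᴴ = 1) ∧ ∀ ρ : Op I, Φ ρ = U * ρ * Uᴴ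

end OneWay

end

/-! The proof is a stabilizer argument. The prepared and entangled state is invariant under `X_x
∏_{w ∼ x} Z_w` for each `x ∉ I` (`isStabilized_graphIsometry`). Take `x = f u`: on the qubit `u`
this stabilizer acts as `Z` if `f u ∼ u` and as `X` if `f u = u`. Either way it exchanges the two
vectors of the measurement basis up to a phase, while its part away from `u` is the prescribed
correction. So result `1`, once corrected, agrees with result `0` up to a phase
(`correction_mul_braAt_mul`), and the phase disappears under conjugation.

The stabilizers needed by later qubits survive the projection of `u`: the flow order prevents `u`
from being `f v` or a neighbour of `f v` for a later `v` (`IsStabilized.braAt_mul`). The whole run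
is therefore conjugation by one matrix. Each measurement halves its Gram matrix
(`conjTranspose_mul_self_braAt_zero`), which is compensated by the two equally contributing values
of the bit, so an isometry results (`exists_runList`). -/

namespace OneWay

/-! ### Conjugation maps -/

section Kraus

variable {m n k : Type*} [Fintype n]

theorem conjBy_conjBy [Fintype m] (K : Matrix k m ℂ) (L : Matrix m n ℂ) (ρ : Matrix n n ℂ) :
    conjBy K (conjBy L ρ) = conjBy (K * L) ρ := by
  simp only [conjBy, Matrix.conjTranspose_mul, Matrix.mul_assoc]

theorem conjBy_one [DecidableEq n] (ρ : Matrix n n ℂ) : conjBy 1 ρ = ρ := by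
  simp [conjBy]

theorem conjBy_zero (K : Matrix m n ℂ) : conjBy K 0 = 0 := by
  simp [conjBy]

theorem conjBy_smul_left (q : ℂ) (K : Matrix m n ℂ) (ρ : Matrix n n ℂ) :
    conjBy (q • K) ρ = (q * star q) • conjBy K ρ := by
  simp [conjBy, smul_smul, mul_comm]

end Kraus

/-! ### Pauli operators and one-qubit projections in the computational basis -/

section Registers

variable {V : Type*} [DecidableEq V] {S : Finset V}

/-- The sign `(-1) ^ y w` of the basis state `y` (`1` if `w ∉ S`). -/
noncomputable def zSign (y : S → Fin 2) (w : V) : ℂ :=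
  if h : w ∈ S then (-1) ^ (y ⟨w, h⟩ : ℕ) else 1

/-- The basis state `y` with the bit of the qubit `w` flipped. -/
def flipAt (w : V) (y : S → Fin 2) : S → Fin 2 :=
  fun v => if v.1 = w then y v + 1 else y v

/-- The basis state of `S` with the bit `c` at `u` that agrees with `x` elsewhere. -/
def extendAt (u : V) (x : S.erase u → Fin 2) (c : Fin 2) : S → Fin 2 :=
  fun v => if h : v.1 = u then c else x ⟨v.1, Finset.mem_erase.2 ⟨h, v.2⟩⟩

theorem zSign_mul_self (y : S → Fin 2) (w : V) : zSign y w * zSign y w = 1 := by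
  unfold zSign
  split
  · rw [← mul_pow]; simp
  · simp

theorem star_zSign (y : S → Fin 2) (w : V) : star (zSign y w) = zSign y w := by
  unfold zSign
  split <;> simp

theorem fin_two_add_one_add_one (c : Fin 2) : c + 1 + 1 = c := by
  fin_cases c <;> rfl

theorem flipAt_flipAt (w : V) (y : S → Fin 2) : flipAt w (flipAt w y) = y := by
  funext v
  unfold flipAt
  split <;> simp [fin_two_add_one_add_one]

theorem zSign_flipAt {w v : V} (h : v ≠ w) (y : S → Fin 2) : zSign (flipAt w y) v = zSign y v := by
  simp [zSign, flipAt, h]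

theorem zSign_extendAt_of_ne {u w : V} (h : w ≠ u) (x : S.erase u → Fin 2) (c : Fin 2) :
    zSign (extendAt u x c) w = zSign x w := by
  simp [zSign, extendAt, h]

theorem zSign_extendAt_self {u : V} (hu : u ∈ S) (x : S.erase u → Fin 2) (c : Fin 2) :
    zSign (extendAt u x c) u = (-1) ^ (c : ℕ) := by
  simp [zSign, extendAt, hu]

theorem flipAt_extendAt_self (u : V) (x : S.erase u → Fin 2) (c : Fin 2) :
    flipAt u (extendAt u x c) = extendAt u x (c + 1) := by
  funext v
  by_cases h : v.1 = u <;> simp [flipAt, extendAt, h]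

theorem flipAt_extendAt_of_ne {u w : V} (h : w ≠ u) (x : S.erase u → Fin 2) (c : Fin 2) :
    flipAt w (extendAt u x c) = extendAt u (flipAt w x) c := by
  funext v
  by_cases hv : v.1 = u
  · simp [flipAt, extendAt, hv, h.symm]
  · simp [flipAt, extendAt, hv]

theorem onQubit_pauliZ_pow (w : V) (b : Fin 2) :
    (onQubit w (pauliZ ^ (b : ℕ)) : Op S) = Matrix.diagonal fun y => zSign y w ^ (b : ℕ) := by
  ext x y
  unfold onQubit zSign
  by_cases hw : w ∈ S
  · simp only [hw, dite_true, Matrix.of_apply, Matrix.diagonal_apply]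
    by_cases hxy : x = y
    · subst hxy
      generalize x ⟨w, hw⟩ = c
      fin_cases b <;> fin_cases c <;> simp [pauliZ]
    · rw [if_neg hxy]
      split_ifs with h
      · have hne : x ⟨w, hw⟩ ≠ y ⟨w, hw⟩ := by
          intro h'
          apply hxy
          funext v
          by_cases hv : v.1 = w
          · obtain ⟨v, hv'⟩ := v
            subst hv
            exact h'
          · exact h v hv
        revert hne
        generalize x ⟨w, hw⟩ = c
        generalize y ⟨w, hw⟩ = d
        fin_cases b <;> fin_cases c <;> fin_cases d <;> simp [pauliZ]
      · rfl
  · simp [hw, Matrix.diagonal_one]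

theorem foldr_zCorr {S : Finset V} (u : V) (l : List V) (σ : CQ S) (s : V → Fin 2) :
    l.foldr (fun w σ => zCorr w u σ) σ s =
      conjBy (Matrix.diagonal fun y => (l.map fun w => zSign y w ^ (s u : ℕ)).prod) (σ s) := by
  induction l with
  | nil => simp [conjBy_one]
  | cons w l ih =>
    simp only [List.foldr_cons, List.map_cons, List.prod_cons]
    rw [zCorr, ih, conjBy_conjBy, onQubit_pauliZ_pow, Matrix.diagonal_mul_diagonal]

theorem onQubit_one (w : V) : (onQubit w 1 : Op S) = 1 := by
  have h := onQubit_pauliZ_pow (S := S) w 0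
  simpa using h

theorem onQubit_pauliX (w : V) :
    (onQubit w pauliX : Op S) = (1 : Op S).submatrix (flipAt w) id := by
  ext x y
  unfold onQubit
  by_cases hw : w ∈ S
  · simp only [hw, dite_true, Matrix.of_apply, Matrix.submatrix_apply, id, Matrix.one_apply]
    by_cases hxy : flipAt w x = y
    · subst hxy
      rw [if_pos rfl, if_pos fun v hv => by simp [flipAt, hv]]
      simp only [flipAt, if_true]
      generalize x ⟨w, hw⟩ = c
      fin_cases c <;> simp [pauliX]
    · rw [if_neg hxy]
      split_ifs with h
      · have hne : x ⟨w, hw⟩ + 1 ≠ y ⟨w, hw⟩ := by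
          intro h'
          apply hxy
          funext v
          by_cases hv : v.1 = w
          · obtain ⟨v, hv'⟩ := v
            subst hv
            simpa [flipAt] using h'
          · simpa [flipAt, hv] using h v hv
        revert hne
        generalize x ⟨w, hw⟩ = c
        generalize y ⟨w, hw⟩ = d
        fin_cases c <;> fin_cases d <;> simp [pauliX]
      · rfl
  · have h : flipAt w = (id : (S → Fin 2) → S → Fin 2) := by
      funext y v
      have : v.1 ≠ w := fun h => hw (h ▸ v.2)
      simp [flipAt, this]
    rw [dif_neg hw, h, Matrix.submatrix_id_id]

theorem braAt_mul_apply {n : Type*} {u : V} (hu : u ∈ S) (φ : Fin 2 → ℂ)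
    (A : Matrix (S → Fin 2) n ℂ) (x : S.erase u → Fin 2) (z : n) :
    ((braAt u φ : Matrix (S.erase u → Fin 2) (S → Fin 2) ℂ) * A) x z = ∑ c, star (φ c) * A (extendAt u x c) z := by
  rw [Matrix.mul_apply]
  have hinj : Function.Injective (extendAt u x) := by
    intro c d h
    have := congrFun h ⟨u, hu⟩
    simpa [extendAt] using this
  rw [← Finset.sum_subset (Finset.subset_univ (Finset.univ.image (extendAt u x))),
    Finset.sum_image fun c _ d _ h => hinj h]
  · refine Finset.sum_congr rfl fun c _ => ?_
    have h1 : ∀ w : S.erase u, x w = extendAt u x c ⟨w.1, Finset.mem_of_mem_erase w.2⟩ := by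
      intro w
      simp [extendAt, Finset.ne_of_mem_erase w.2]
    have h2 : extendAt u x c ⟨u, hu⟩ = c := by simp [extendAt]
    simp only [braAt, Matrix.of_apply, if_pos h1, dif_pos hu, h2]
  · intro y _ hy
    have : ¬ ∀ w : S.erase u, x w = y ⟨w.1, Finset.mem_of_mem_erase w.2⟩ := by
      intro h
      apply hy
      refine Finset.mem_image.2 ⟨y ⟨u, hu⟩, Finset.mem_univ _, ?_⟩
      funext v
      by_cases hv : v.1 = u
      · obtain ⟨v, hv'⟩ := v
        subst hv
        simp [extendAt]
      · simpa [extendAt, hv] using h ⟨v.1, Finset.mem_erase.2 ⟨hv, v.2⟩⟩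
    simp only [braAt, Matrix.of_apply, if_neg this, zero_mul]

/-- The completeness relation of a one-qubit basis, tensored with the identity on the other qubits.
-/
theorem sum_conjTranspose_braAt_mul_braAt {u : V} (hu : u ∈ S) (φ : Fin 2 → Fin 2 → ℂ)
    (hφ : ∀ c d, ∑ b, φ b c * star (φ b d) = if c = d then 1 else 0) :
    ∑ b, (braAt (S := S) u (φ b))ᴴ * braAt (S := S) u (φ b) = 1 := by
  ext y y'
  let r : (S → Fin 2) → S.erase u → Fin 2 :=
    fun y w => y ⟨w.1, Finset.mem_of_mem_erase w.2⟩
  have hbra : ∀ (b : Fin 2) (x : S.erase u → Fin 2) (y : S → Fin 2),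
      braAt u (φ b) x y = if x = r y then star (φ b (y ⟨u, hu⟩)) else 0 := by
    intro b x y
    simp only [braAt, Matrix.of_apply, dif_pos hu, r, funext_iff]
  have hext : y = y' ↔ r y = r y' ∧ y ⟨u, hu⟩ = y' ⟨u, hu⟩ := by
    refine ⟨fun h => h ▸ ⟨rfl, rfl⟩, fun ⟨h1, h2⟩ => funext fun v => ?_⟩
    by_cases hv : v.1 = u
    · obtain ⟨v, hv'⟩ := v
      subst hv
      exact h2
    · exact congrFun h1 ⟨v.1, Finset.mem_erase.2 ⟨hv, v.2⟩⟩
  simp only [Matrix.sum_apply, Matrix.mul_apply, Matrix.conjTranspose_apply, hbra, Matrix.one_apply]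
  simp only [apply_ite star, star_star, star_zero, ite_mul, zero_mul, mul_ite, mul_zero,
    Finset.sum_ite_eq', Finset.mem_univ, if_true]
  by_cases hr : r y = r y'
  · simp only [hr, if_true, hφ, hext, true_and]
  · simp [hr, Ne.symm hr, hext]

end Registers

/-! ### Action of `X` and `Z` on the measurement bases -/

theorem sum_measKet_mul_star (p : Plane) (θ : ℝ) (c d : Fin 2) :
    ∑ b, measKet p θ b c * star (measKet p θ b d) = if c = d then 1 else 0 := by
  have h2 : (Real.sqrt 2 : ℂ) ^ 2 = 2 := by
    rw [← Complex.ofReal_pow, Real.sq_sqrt (by norm_num)]; simp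
  have h0 : (Real.sqrt 2 : ℂ) ≠ 0 := by simp
  have hm : Complex.exp (-(Complex.I * θ)) = (Complex.exp (Complex.I * θ))⁻¹ := Complex.exp_neg _
  have hs : (starRingEnd ℂ) (Complex.exp (Complex.I * θ)) = (Complex.exp (Complex.I * θ))⁻¹ := by
    rw [← Complex.exp_conj, ← Complex.exp_neg]; simp
  have he : Complex.exp (Complex.I * θ) ≠ 0 := Complex.exp_ne_zero _
  cases p <;> fin_cases c <;> fin_cases d <;>
    simp [measKet, Fin.sum_univ_two, hm, hs, -Complex.ofReal_eq_zero] <;> field_simp <;>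
    first | ring1 | linear_combination -h2

/-- `Z` exchanges the two `XY` vectors at every angle, with no phase; in the `YZ` plane `X` plays
this role. -/
theorem measKet_xy_one (θ : ℝ) (c : Fin 2) :
    (-1) ^ (c : ℕ) * measKet Plane.XY θ 1 c = measKet Plane.XY θ 0 c := by
  fin_cases c <;> simp [measKet, neg_div]

theorem measKet_yz_one (θ : ℝ) (c : Fin 2) :
    measKet Plane.YZ θ 1 (c + 1) = measKet Plane.YZ θ 0 c := by
  fin_cases c <;> simp [measKet, sub_eq_add_neg]

theorem exp_sq_eq_neg_one {θ : ℝ} (h : θ = Real.pi / 2 ∨ θ = -(Real.pi / 2)) :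
    Complex.exp (Complex.I * θ) ^ 2 = -1 := by
  rw [← Complex.exp_nat_mul]
  rcases h with rfl | rfl
  · rw [← Complex.exp_pi_mul_I]; congr 1; push_cast; ring
  · rw [← inv_inj, ← Complex.exp_neg, inv_neg_one, ← Complex.exp_pi_mul_I]
    congr 1; push_cast; ring

theorem exp_mul_star_exp (θ : ℝ) :
    Complex.exp (Complex.I * θ) * star (Complex.exp (Complex.I * θ)) = 1 := by
  rw [Complex.star_def, ← Complex.exp_conj, ← Complex.exp_add]; simp

/-- At these angles the basis consists of eigenvectors of `Y`, so the other Pauli exchanges them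
too. The entry `c = 0` forces the phase `-e^{iθ}`, and the entry `c = 1` then needs `e^{2iθ} = -1`.
-/
theorem exists_phase_xy_flip {θ : ℝ} (h : θ = Real.pi / 2 ∨ θ = -(Real.pi / 2)) :
    ∃ q : ℂ, q * star q = 1 ∧
      ∀ c, measKet Plane.XY θ 1 (c + 1) = q * measKet Plane.XY θ 0 c := by
  refine ⟨-Complex.exp (Complex.I * θ), by simpa using exp_mul_star_exp θ, fun c => ?_⟩
  have h2 := exp_sq_eq_neg_one h
  fin_cases c
  · simp [measKet, div_eq_mul_inv]
  · simp only [measKet]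
    simp
    rw [← mul_div_assoc, ← sq, h2]
    ring

theorem exists_phase_yz_sign {θ : ℝ} (h : θ = Real.pi / 2 ∨ θ = -(Real.pi / 2)) :
    ∃ q : ℂ, q * star q = 1 ∧
      ∀ c : Fin 2, (-1) ^ (c : ℕ) * measKet Plane.YZ θ 1 c = q * measKet Plane.YZ θ 0 c := by
  have h' : -θ = Real.pi / 2 ∨ -θ = -(Real.pi / 2) := by
    rcases h with rfl | rfl <;> simp
  have hm : -(Complex.I * θ) = Complex.I * ((-θ : ℝ) : ℂ) := by push_cast; ring
  refine ⟨-Complex.exp (Complex.I * (-θ : ℝ)), by simpa using exp_mul_star_exp (-θ), fun c => ?_⟩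
  have h2 := exp_sq_eq_neg_one h'
  simp only [measKet, hm]
  generalize Complex.exp (Complex.I * (-θ : ℝ)) = e at h2
  fin_cases c
  · simp; linear_combination (1 / 2) * h2
  · simp; linear_combination -(1 / 2) * h2

/-! ### Stabilizers and the effect of corrected measurements -/

section Step

variable {V : Type*} [Fintype V] [DecidableEq V] (G : SimpleGraph V) [DecidableRel G.Adj]

/-- The columns of `A` are invariant under the graph state stabilizer `X_x ∏_{w ∼ x} Z_w`. -/
def IsStabilized {S : Finset V} {n : Type*} (x : V) (A : Matrix (S → Fin 2) n ℂ) : Prop :=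
  ∀ y z, A y z = (∏ w ∈ G.neighborFinset x, zSign y w) * A (flipAt x y) z

/-- The correction made after the measurement of `u` with result `b`. -/
noncomputable def correction {S : Finset V} (u fu : V) (b : Fin 2) : Op (S.erase u) :=
  Matrix.diagonal (fun y => ∏ w ∈ (G.neighborFinset fu).erase u, zSign y w ^ (b : ℕ)) *
    onQubit fu (pauliX ^ (b : ℕ))

theorem measureAndCorrect_apply {S : Finset V} (p : Plane) (u fu : V) (θ : ℝ) (σ : CQ S)
    (s : V → Fin 2) :
    measureAndCorrect G p u θ fu σ s =
      conjBy (correction (S := S) G u fu (s u) * braAt (S := S) u (measKet p θ (s u)))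
        (∑ b, σ (Function.update s u b)) := by
  unfold measureAndCorrect correction
  rw [foldr_zCorr, Matrix.mul_assoc, ← conjBy_conjBy]
  congr 1
  · congr 1
    funext y
    exact Finset.prod_map_toList _ _
  · rw [← conjBy_conjBy]
    split_ifs with h
    · rfl
    -- When `fu = u` the procedure has no `X` correction; `correction` still fits, since `onQubit`
    -- at a qubit absent from `S.erase u` is the identity.
    · push Not at h
      subst h
      have : (onQubit fu (pauliX ^ (s fu : ℕ)) : Op (S.erase fu)) = 1 := by
        simp [onQubit]
      rw [this, conjBy_one]
      rfl

theorem correction_zero {S : Finset V} (u fu : V) :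
    correction (S := S) G u fu 0 = 1 := by
  simp [correction, onQubit_one]

theorem correction_one_mul_apply {S : Finset V} {n : Type*} (u fu : V)
    (A : Matrix (S.erase u → Fin 2) n ℂ) (x : S.erase u → Fin 2) (z : n) :
    (correction (S := S) G u fu 1 * A) x z =
      (∏ w ∈ (G.neighborFinset fu).erase u, zSign x w) * A (flipAt fu x) z := by
  simp only [correction, Fin.val_one, pow_one, onQubit_pauliX]
  rw [Matrix.mul_assoc, Matrix.diagonal_mul]
  congr 1
  simp [Matrix.mul_apply, Matrix.one_apply]

theorem conjTranspose_correction_one_mul_self {S : Finset V} (u fu : V) :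
    (correction (S := S) G u fu 1)ᴴ * correction (S := S) G u fu 1 = 1 := by
  have hF : ((1 : Op (S.erase u)).submatrix (flipAt fu) id)ᴴ *
      (1 : Op (S.erase u)).submatrix (flipAt fu) id = 1 := by
    have hH : ((1 : Op (S.erase u)).submatrix (flipAt fu) id)ᴴ =
        (1 : Op (S.erase u)).submatrix (flipAt fu) id := by
      ext y y'
      have : flipAt fu y' = y ↔ flipAt fu y = y' :=
        ⟨fun h => h ▸ flipAt_flipAt fu y', fun h => h ▸ flipAt_flipAt fu y⟩
      simp only [Matrix.conjTranspose_apply, Matrix.submatrix_apply, id, Matrix.one_apply, this]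
      split_ifs <;> simp
    rw [hH]
    ext y y'
    simp only [Matrix.mul_apply, Matrix.submatrix_apply, id, Matrix.one_apply, ite_mul, one_mul,
      zero_mul, Finset.sum_ite_eq, Finset.mem_univ, if_true, flipAt_flipAt]
  simp only [correction, Fin.val_one, pow_one, onQubit_pauliX]
  rw [Matrix.conjTranspose_mul, Matrix.mul_assoc, ← Matrix.mul_assoc _ (Matrix.diagonal _),
    Matrix.diagonal_conjTranspose, Matrix.diagonal_mul_diagonal]
  have h1 : ∀ y : S.erase u → Fin 2,
      star (fun y => ∏ w ∈ (G.neighborFinset fu).erase u, zSign y w) y *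
        ∏ w ∈ (G.neighborFinset fu).erase u, zSign y w = 1 := by
    intro y
    rw [Pi.star_apply, star_prod, ← Finset.prod_mul_distrib]
    exact Finset.prod_eq_one fun w _ => by rw [star_zSign, zSign_mul_self]
  simp only [h1, Matrix.diagonal_one, Matrix.one_mul, hF]

/-- The columns of a matrix remain stabilized when a qubit outside of the support of the stabilizer
is projected. -/
theorem IsStabilized.braAt_mul {G : SimpleGraph V} [DecidableRel G.Adj] {S : Finset V} {n : Type*}
    {u x : V} (hu : u ∈ S) (hx : x ≠ u) (hadj : ¬ G.Adj x u) {A : Matrix (S → Fin 2) n ℂ}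
    (hA : IsStabilized G x A) (φ : Fin 2 → ℂ) :
    IsStabilized G x (braAt (S := S) u φ * A) := by
  intro y z
  rw [braAt_mul_apply hu, braAt_mul_apply hu, Finset.mul_sum]
  refine Finset.sum_congr rfl fun c _ => ?_
  rw [hA, flipAt_extendAt_of_ne hx, mul_left_comm]
  congr 1
  refine Finset.prod_congr rfl fun w hw => zSign_extendAt_of_ne ?_ _ _
  rintro rfl
  exact hadj (by simpa using hw)

/-- After its correction, the result `1` of a measurement has the same effect as the result `0`, up
to a phase. -/
theorem correction_mul_braAt_mul {S : Finset V} {n : Type*} {u fu : V} (hu : u ∈ S)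
    {φ : Fin 2 → Fin 2 → ℂ} {q : ℂ}
    (h : (G.Adj fu u ∧ ∀ c : Fin 2, (-1) ^ (c : ℕ) * φ 1 c = q * φ 0 c) ∨
      (fu = u ∧ ∀ c, φ 1 (c + 1) = q * φ 0 c))
    {A : Matrix (S → Fin 2) n ℂ} (hA : IsStabilized G fu A) :
    correction (S := S) G u fu 1 * (braAt (S := S) u (φ 1) * A) =
      star q • (braAt (S := S) u (φ 0) * A) := by
  ext x z
  rw [correction_one_mul_apply, Matrix.smul_apply, braAt_mul_apply hu, braAt_mul_apply hu,
    smul_eq_mul, Finset.mul_sum, Finset.mul_sum]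
  have hext : ∀ c, ∏ w ∈ (G.neighborFinset fu).erase u, zSign (extendAt u x c) w =
      ∏ w ∈ (G.neighborFinset fu).erase u, zSign x w := fun c =>
    Finset.prod_congr rfl fun w hw => zSign_extendAt_of_ne (Finset.ne_of_mem_erase hw) _ _
  rcases h with ⟨hadj, hφ⟩ | ⟨rfl, hφ⟩
  · have hmem : u ∈ G.neighborFinset fu := by simpa using hadj
    -- The stabilizer contributes `Z` on `u`, that is the sign `(-1) ^ c`, which turns `φ 1` into `q
    -- • φ 0`; its remaining factors cancel the correction.
    refine Finset.sum_congr rfl fun c _ => ?_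
    rw [hA (extendAt u x c), ← Finset.mul_prod_erase _ _ hmem, hext, zSign_extendAt_self hu,
      flipAt_extendAt_of_ne hadj.ne, ← mul_assoc (star q), ← star_mul', ← hφ]
    simp only [star_mul', star_pow, star_neg, star_one]
    have hc : ((-1 : ℂ) ^ (c : ℕ)) * (-1) ^ (c : ℕ) = 1 := by rw [← mul_pow]; simp
    linear_combination -(star (φ 1 c) * (∏ w ∈ (G.neighborFinset fu).erase u, zSign x w) *
      A (extendAt u (flipAt fu x) c) z) * hc
  -- Here the stabilizer flips `u` itself, so the sum over its bit is reindexed by `c ↦ c + 1`; the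
  -- rest of the correction is the full product of signs, as `u` is not its own neighbour.
  · have hx : flipAt fu x = x := by
      funext v
      simp [flipAt, Finset.ne_of_mem_erase v.2]
    have hnot : fu ∉ G.neighborFinset fu := by simp
    rw [Finset.erase_eq_of_notMem hnot] at hext ⊢
    rw [hx, ← Equiv.sum_comp (Equiv.addRight (1 : Fin 2))]
    refine Finset.sum_congr rfl fun c _ => ?_
    rw [hA (extendAt fu x c), hext, flipAt_extendAt_self, Equiv.coe_addRight, hφ, star_mul']
    ring

/-- The correction is unitary and `q` is a phase, so both results have the same Gram matrix. By
completeness the two add up to `Aᴴ * A`, hence each is half of it. -/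
theorem conjTranspose_mul_self_braAt_zero {S : Finset V} {n : Type*} {u fu : V} (hu : u ∈ S)
    {φ : Fin 2 → Fin 2 → ℂ}
    (hφ : ∀ c d, ∑ b, φ b c * star (φ b d) = if c = d then 1 else 0) {q : ℂ}
    (hq : q * star q = 1) {A : Matrix (S → Fin 2) n ℂ}
    (h : correction (S := S) G u fu 1 * (braAt (S := S) u (φ 1) * A) =
      star q • (braAt (S := S) u (φ 0) * A)) :
    (braAt (S := S) u (φ 0) * A)ᴴ * (braAt (S := S) u (φ 0) * A) =
      (1 / 2 : ℂ) • (Aᴴ * A) := by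
  have h1 : (braAt (S := S) u (φ 1) * A)ᴴ *
      (braAt (S := S) u (φ 1) * A) =
      (braAt (S := S) u (φ 0) * A)ᴴ * (braAt (S := S) u (φ 0) * A) := by
    have := congrArg (fun M => Mᴴ * M) h
    simp only [Matrix.conjTranspose_smul, star_star, Matrix.smul_mul, Matrix.mul_smul,
      smul_smul, mul_comm (star q), hq, one_smul] at this
    rw [← this, Matrix.conjTranspose_mul (correction (S := S) G u fu 1), Matrix.mul_assoc,
      ← Matrix.mul_assoc _ (correction (S := S) G u fu 1), conjTranspose_correction_one_mul_self,
      Matrix.one_mul]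
  have h2 := congrArg (fun M => Aᴴ * M * A) (sum_conjTranspose_braAt_mul_braAt hu φ hφ)
  simp only [Fin.sum_univ_two, Matrix.mul_add, Matrix.add_mul, Matrix.mul_one] at h2
  simp only [Matrix.conjTranspose_mul, Matrix.mul_assoc] at h1 h2 ⊢
  rw [h1, ← two_smul ℂ] at h2
  rw [← h2, smul_smul]
  norm_num

/-- The hypothesis on one measured qubit `u` of a pattern: the measurement basis is compatible with
the position of `fu`. -/
def IsCompatible (p : Plane) (θ : ℝ) (u fu : V) : Prop :=
  ∃ q : ℂ, q * star q = 1 ∧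
    ((G.Adj fu u ∧ ∀ c : Fin 2, (-1) ^ (c : ℕ) * measKet p θ 1 c = q * measKet p θ 0 c) ∨
      (fu = u ∧ ∀ c, measKet p θ 1 (c + 1) = q * measKet p θ 0 c))

/-- The state `ρ` together with uniformly random bits on `M` and zero bits elsewhere
(unnormalized). -/
def withBits {S : Finset V} (M : Finset V) (ρ : Op S) : CQ S :=
  fun s => if ∀ v, v ∉ M → s v = 0 then ρ else 0

/-- Both values of the new bit come with the same state, so `u` merely joins the set of uniformly
random bits. -/
theorem measureAndCorrect_withBits {S M : Finset V} {n : Type*} [Fintype n] {p : Plane} {θ : ℝ}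
    {u fu : V} (hu : u ∈ S) (huM : u ∉ M) (hc : IsCompatible G p θ u fu)
    {A : Matrix (S → Fin 2) n ℂ} (hA : IsStabilized G fu A) (ρ : Matrix n n ℂ) :
    measureAndCorrect G p u θ fu (withBits M (conjBy A ρ)) =
      withBits (insert u M) (conjBy (braAt (S := S) u (measKet p θ 0) * A) ρ) := by
  obtain ⟨q, hq, h⟩ := hc
  funext s
  -- Before the measurement the bit of `u` is `0`, so only `b = 0` survives in the sum over its
  -- discarded value.
  have h1 : ¬ ∀ v, v ∉ M → Function.update s u 1 v = 0 := fun h => by simpa using h u huM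
  have h0 : (∀ v, v ∉ M → Function.update s u 0 v = 0) ↔ ∀ v, v ∉ insert u M → s v = 0 := by
    refine ⟨fun h v hv => ?_, fun h v hv => ?_⟩
    · rw [Finset.mem_insert, not_or] at hv
      simpa [hv.1] using h v hv.2
    · by_cases hvu : v = u
      · simp [hvu]
      · simpa [hvu] using h v (by simp [hvu, hv])
  rw [measureAndCorrect_apply, Fin.sum_univ_two]
  simp only [withBits, if_neg h1, h0, add_zero]
  split_ifs with hs
  · rw [conjBy_conjBy, Matrix.mul_assoc]
    rcases Fin.exists_fin_two.1 ⟨s u, rfl⟩ with hb | hb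
    · rw [hb, correction_zero, Matrix.one_mul]
    · rw [hb, correction_mul_braAt_mul G hu h hA, conjBy_smul_left, star_star, mul_comm, hq,
        one_smul]
  · exact conjBy_zero _

theorem sum_withBits {S : Finset V} (M : Finset V) (ρ : Op S) :
    ∑ s, withBits M ρ s = (2 ^ M.card : ℂ) • ρ := by
  have : (Finset.univ.filter fun s : V → Fin 2 => ∀ v, v ∉ M → s v = 0) =
      Fintype.piFinset fun v => if v ∈ M then Finset.univ else {0} := by
    ext s
    simp only [Finset.mem_filter, Finset.mem_univ, true_and, Fintype.mem_piFinset]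
    refine forall_congr' fun v => ?_
    split_ifs with h <;> simp [h]
  simp only [withBits]
  rw [← Finset.sum_filter, Finset.sum_const, this, Fintype.card_piFinset]
  simp only [apply_ite Finset.card, Finset.card_univ, Fintype.card_fin, Finset.card_singleton]
  rw [Finset.prod_ite]
  simp [← Nat.cast_smul_eq_nsmul ℂ]

/-- Induction on the qubits still to be measured, with `M` the bits already randomized. `hlater` is
what keeps the stabilizers of later qubits intact when the head is projected. -/
theorem exists_runList {D : Finset V} (plane : V → Plane) (θ : V → ℝ) (f : D → V) {n : Type*}
    [Fintype n] (l : List D) (hl : l.Nodup)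
    (hlater : l.Pairwise fun u v => f v ≠ u.1 ∧ ¬ G.Adj (f v) u.1)
    (hc : ∀ u ∈ l, IsCompatible G (plane u) (θ u) u (f u)) (S M : Finset V)
    (hS : ∀ u ∈ l, u.1 ∈ S) (hM : ∀ u ∈ l, u.1 ∉ M) (A : Matrix (S → Fin 2) n ℂ)
    (hA : ∀ u ∈ l, IsStabilized G (f u) A) :
    ∃ B : Matrix (remaining l S → Fin 2) n ℂ, Bᴴ * B = Aᴴ * A ∧
      ∀ ρ, ∑ s, runList G plane θ f l S (withBits M (conjBy A ρ)) s =
        (2 ^ M.card : ℂ) • conjBy B ρ := by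
  induction l generalizing S M with
  | nil => exact ⟨A, rfl, fun ρ => sum_withBits M _⟩
  | cons u l ih =>
    rw [List.nodup_cons] at hl
    rw [List.pairwise_cons] at hlater
    simp only [List.forall_mem_cons] at hc hS hM hA
    have hne : ∀ v ∈ l, v.1 ≠ u.1 := fun v hv h => hl.1 (Subtype.ext h ▸ hv)
    obtain ⟨B, hB, hrun⟩ := ih hl.2 hlater.2 hc.2 (S.erase u) (insert u.1 M)
      (fun v hv => Finset.mem_erase.2 ⟨hne v hv, hS.2 v hv⟩)
      (fun v hv => by simp [hne v hv, hM.2 v hv])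
      (braAt (S := S) u (measKet (plane u) (θ u) 0) * A)
      (fun v hv => (hA.2 v hv).braAt_mul hS.1 (hlater.1 v hv).1 (hlater.1 v hv).2 _)
    have hsqrt : (Real.sqrt 2 : ℂ) * Real.sqrt 2 = 2 := by
      rw [← Complex.ofReal_mul, Real.mul_self_sqrt (by norm_num)]; simp
    change ∃ B : Matrix (remaining l (S.erase u.1) → Fin 2) n ℂ, Bᴴ * B = Aᴴ * A ∧
      ∀ ρ, ∑ s, runList G plane θ f l (S.erase u.1)
        (measureAndCorrect G (plane u) u (θ u) (f u) (withBits M (conjBy A ρ))) s =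
          (2 ^ M.card : ℂ) • conjBy B ρ
    -- The factor `√2` undoes the halving of the Gram matrix, and under conjugation it absorbs the
    -- extra factor `2` from the enlarged bit set.
    refine ⟨(Real.sqrt 2 : ℂ) • B, ?_, fun ρ => ?_⟩
    · obtain ⟨q, hq, h⟩ := hc.1
      rw [conjTranspose_mul_self_braAt_zero G hS.1 (sum_measKet_mul_star _ _) hq
        (correction_mul_braAt_mul G hS.1 h hA.1)] at hB
      rw [Matrix.conjTranspose_smul, Matrix.smul_mul, Matrix.mul_smul, hB, smul_smul, smul_smul]
      simp [hsqrt]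
    · rw [measureAndCorrect_withBits G hS.1 hM.1 hc.1 hA.1, hrun,
        Finset.card_insert_of_notMem hM.1, conjBy_smul_left, smul_smul, pow_succ]
      simp [hsqrt]

end Step

/-! ### The graph state isometry and its stabilizers -/

section Initial

variable {V : Type*} [DecidableEq V]

/-- The sign by which the controlled-`Z` operator on `e` multiplies the basis state `y`. -/
noncomputable def czSign {S : Finset V} (y : S → Fin 2) (e : Sym2 V) : ℂ :=
  open Classical in if (∀ v : S, v.1 ∈ e → y v = 1) then -1 else 1

theorem foldr_entangle {S : Finset V} (l : List (Sym2 V)) (σ : CQ S) (s : V → Fin 2) :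
    l.foldr entangle σ s =
      conjBy (Matrix.diagonal fun y => (l.map (czSign y)).prod) (σ s) := by
  induction l with
  | nil => simp [conjBy_one]
  | cons e l ih =>
    have : (czOp e : Op S) = Matrix.diagonal fun y => czSign y e := rfl
    simp only [List.foldr_cons, List.map_cons, List.prod_cons]
    rw [entangle, ih, conjBy_conjBy, this, Matrix.diagonal_mul_diagonal]

theorem adjoinPlus_flipAt {S T : Finset V} (h : S ⊆ T) {x : V} (hx : x ∉ S) (y : T → Fin 2)
    (z : S → Fin 2) : adjoinPlus h (flipAt x y) z = adjoinPlus h y z := by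
  have hw : ∀ w : S, flipAt x y ⟨w.1, h w.2⟩ = y ⟨w.1, h w.2⟩ := fun w =>
    if_neg fun (hwx : w.1 = x) => hx (hwx ▸ w.2)
  simp only [adjoinPlus, Matrix.of_apply, ketPlus, hw]

/-- The entries are products over the qubits of `T`, so the Gram matrix factorizes: a Kronecker
delta for each qubit of `S`, and `1/2 + 1/2` for each new qubit. -/
theorem conjTranspose_adjoinPlus_mul_self {S T : Finset V} (h : S ⊆ T) :
    (adjoinPlus (S := S) (T := T) h)ᴴ * adjoinPlus (S := S) (T := T) h = 1 := by
  have h2 : (Real.sqrt 2 : ℂ) * Real.sqrt 2 = 2 := by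
    rw [← Complex.ofReal_mul, Real.mul_self_sqrt (by norm_num)]; simp
  have hprod : ∀ (y : T → Fin 2) (z : S → Fin 2), adjoinPlus h y z =
      ∏ v : T, if hv : v.1 ∈ S then (if y v = z ⟨v.1, hv⟩ then 1 else 0)
        else (1 / (Real.sqrt 2 : ℂ)) := by
    intro y z
    simp only [adjoinPlus, Matrix.of_apply]
    split_ifs with hy
    · refine Finset.prod_congr rfl fun v _ => ?_
      split_ifs with hv hyv
      · rfl
      · exact absurd (hy ⟨v.1, hv⟩) hyv
      · rfl
    · push Not at hy
      obtain ⟨w, hw⟩ := hy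
      refine (Finset.prod_eq_zero (Finset.mem_univ ⟨w.1, h w.2⟩) ?_).symm
      simp [hw]
  ext z z'
  simp only [Matrix.mul_apply, Matrix.conjTranspose_apply, hprod, star_prod,
    ← Finset.prod_mul_distrib]
  rw [← Fintype.piFinset_univ, ← Finset.prod_univ_sum (fun _ : T => (Finset.univ : Finset (Fin 2)))
    fun v b => star (if hv : v.1 ∈ S then (if b = z ⟨v.1, hv⟩ then 1 else 0)
        else (1 / (Real.sqrt 2 : ℂ))) * (if hv : v.1 ∈ S then (if b = z' ⟨v.1, hv⟩ then 1 else 0)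
        else (1 / (Real.sqrt 2 : ℂ)))]
  have hfac : ∀ v : T, (∑ b : Fin 2, star (if hv : v.1 ∈ S then (if b = z ⟨v.1, hv⟩ then 1 else 0)
        else (1 / (Real.sqrt 2 : ℂ))) * (if hv : v.1 ∈ S then (if b = z' ⟨v.1, hv⟩ then 1 else 0)
        else (1 / (Real.sqrt 2 : ℂ)))) =
      if hv : v.1 ∈ S then (if z ⟨v.1, hv⟩ = z' ⟨v.1, hv⟩ then 1 else 0) else 1 := by
    intro v
    split_ifs with hv hz
    · simp [apply_ite star, hz]
    · simp [apply_ite star, Ne.symm hz]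
    · simp [← mul_inv, h2]
  rw [Finset.prod_congr rfl fun v _ => hfac v, Matrix.one_apply]
  split_ifs with hz
  · subst hz
    exact Finset.prod_eq_one fun v _ => by simp
  · obtain ⟨w, hw⟩ := Function.ne_iff.1 hz
    refine Finset.prod_eq_zero (Finset.mem_univ ⟨w.1, h w.2⟩) ?_
    simp [hw]

variable [Fintype V] (G : SimpleGraph V) [DecidableRel G.Adj]

/-- Moving `X_x` through a controlled-`Z` leaves a `Z` on the other end of the edge, and nothing if
`x` is not an end. -/
theorem czSign_flipAt {x : V} (y : ↥(Finset.univ : Finset V) → Fin 2) {e : Sym2 V}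
    (he : e ∈ G.edgeFinset) :
    czSign (flipAt x y) e =
      czSign y e * ∏ w ∈ G.neighborFinset x, if e = s(x, w) then zSign y w else 1 := by
  by_cases hx : x ∈ e
  · obtain ⟨b, rfl⟩ := hx
    rw [SimpleGraph.mem_edgeFinset, SimpleGraph.mem_edgeSet] at he
    have hb : b ∈ G.neighborFinset x := by simpa using he
    simp only [Sym2.congr_right, Finset.prod_ite_eq, hb, if_true]
    simp only [czSign, zSign, flipAt, Subtype.forall, Finset.mem_univ, forall_true_left,
      Sym2.mem_iff, forall_eq_or_imp, forall_eq, if_true, dite_true, if_neg he.ne']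
    generalize y ⟨x, _⟩ = c
    generalize y ⟨b, _⟩ = d
    fin_cases c <;> fin_cases d <;> simp
  · rw [Finset.prod_eq_one, mul_one]
    · unfold czSign
      congr 1
      refine propext (forall_congr' fun v => forall_congr' fun hv => ?_)
      have : v.1 ≠ x := fun h => hx (h ▸ hv)
      simp [flipAt, this]
    · intro w _
      rw [if_neg]
      rintro rfl
      exact hx (Sym2.mem_mk_left x w)

/-- The isometry that adjoins the qubits outside `I` in the state `|+⟩` and entangles along the
edges of `G`. -/
noncomputable def graphIsometry (I : Finset V) :
    Matrix (↥(Finset.univ : Finset V) → Fin 2) (I → Fin 2) ℂ :=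
  Matrix.diagonal (fun y : ↥(Finset.univ : Finset V) → Fin 2 => ∏ e ∈ G.edgeFinset, czSign y e) *
    adjoinPlus (S := I) (T := Finset.univ) (Finset.subset_univ I)

/-- A qubit in `|+⟩` is invariant under `X`; moving this `X_x` through the edges at `x` produces the
factors `Z_w`. -/
theorem isStabilized_graphIsometry {I : Finset V} {x : V} (hx : x ∉ I) :
    IsStabilized G x (graphIsometry G I) := by
  intro y z
  have h1 : ∏ e ∈ G.edgeFinset, czSign (flipAt x y) e =
      (∏ e ∈ G.edgeFinset, czSign y e) * ∏ w ∈ G.neighborFinset x, zSign y w := by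
    rw [Finset.prod_congr rfl fun e he => czSign_flipAt G y he, Finset.prod_mul_distrib,
      Finset.prod_comm]
    congr 1
    refine Finset.prod_congr rfl fun w hw => ?_
    rw [Finset.prod_ite_eq', if_pos]
    simpa using hw
  have h2 : (∏ w ∈ G.neighborFinset x, zSign y w) * ∏ w ∈ G.neighborFinset x, zSign y w = 1 := by
    rw [← Finset.prod_mul_distrib]
    exact Finset.prod_eq_one fun w _ => zSign_mul_self y w
  rw [graphIsometry, Matrix.diagonal_mul, Matrix.diagonal_mul, adjoinPlus_flipAt _ hx, h1]
  linear_combination -((∏ e ∈ G.edgeFinset, czSign y e) *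
    adjoinPlus (Finset.subset_univ I) y z) * h2

theorem conjTranspose_graphIsometry_mul_self (I : Finset V) :
    (graphIsometry G I)ᴴ * graphIsometry G I = 1 := by
  have h : ∀ y : ↥(Finset.univ : Finset V) → Fin 2,
      star (fun y => ∏ e ∈ G.edgeFinset, czSign y e) y * ∏ e ∈ G.edgeFinset, czSign y e = 1 := by
    intro y
    rw [Pi.star_apply, star_prod, ← Finset.prod_mul_distrib]
    refine Finset.prod_eq_one fun e _ => ?_
    unfold czSign
    split <;> simp
  rw [graphIsometry, Matrix.conjTranspose_mul, Matrix.mul_assoc,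
    ← Matrix.mul_assoc _ (Matrix.diagonal _), Matrix.diagonal_conjTranspose,
    Matrix.diagonal_mul_diagonal]
  simp only [h, Matrix.diagonal_one, Matrix.one_mul, conjTranspose_adjoinPlus_mul_self]

theorem entangleGraph_prepare_initial {I : Finset V} (ρ : Op I) :
    entangleGraph G (prepare (Finset.subset_univ I) (initial ρ)) =
      withBits ∅ (conjBy (graphIsometry G I) ρ) := by
  funext s
  have hs : (∀ v, v ∉ (∅ : Finset V) → s v = 0) ↔ s = 0 := by simp [funext_iff]
  simp only [entangleGraph, foldr_entangle, prepare, conjBy_conjBy, withBits, hs, initial]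
  split_ifs
  · unfold graphIsometry
    congr 3
    funext y
    exact Finset.prod_map_toList _ _
  · exact conjBy_zero _

end Initial

/-! ### From an isometry to the theorem -/

theorem performsUnitary_of_isometry {V : Type*} [DecidableEq V] {I O T : Finset V} (h : T = O)
    {Φ : Op I → Op O} {B : Matrix (T → Fin 2) (I → Fin 2) ℂ} (hB : Bᴴ * B = 1)
    (hΦ : ∀ ρ, Φ ρ = castOp h (conjBy B ρ)) : PerformsUnitary Φ := by
  subst h
  refine ⟨B, hB, fun hcard => ?_, hΦ⟩
  exact (Matrix.mul_eq_one_comm_of_card_eq _ _ _ (by simp [hcard])).1 hB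

end OneWay

theorem mainTheorem10 {V : Type*} [Fintype V] [LinearOrder V] (G : SimpleGraph V)
    [DecidableRel G.Adj] (I O MXY MYZ : Finset V) (hM : MXY ∪ MYZ = Oᶜ)
    (f : {v // v ∈ Oᶜ} → {v // v ∈ Iᶜ}) (prec : V → V → Prop)
    (hf : OneWay.IsExtendedFlow G I O MXY MYZ f prec)
    (hle : ∀ v w : V, prec v w → v ≤ w)
    (plane : V → OneWay.Plane)
    (hXY : ∀ u ∈ Oᶜ, plane u = OneWay.Plane.XY → u ∈ MXY)
    (hYZ : ∀ u ∈ Oᶜ, plane u = OneWay.Plane.YZ → u ∈ MYZ)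
    (θ : V → ℝ)
    (hθ : ∀ u ∈ MXY ∩ MYZ, θ u = Real.pi / 2 ∨ θ u = -(Real.pi / 2)) :
    OneWay.PerformsUnitary (OneWay.procedure G I O f plane θ) := by
  -- `XY` naturally goes with `f u ∼ u` and `YZ` with `f u = u`. The mismatched pairings occur only
  -- in `MXY ∩ MYZ`, where `hθ` makes the basis that of `Y`.
  have hc : ∀ u : {v // v ∈ Oᶜ}, OneWay.IsCompatible G (plane u) (θ u) u (f u).1 := by
    intro u
    cases hp : plane u with
    | XY =>
      have hu := hXY u u.2 hp
      have hsign := OneWay.measKet_xy_one (θ u)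
      by_cases hu' : u.1 ∈ MYZ
      · rcases hf.adj_or_eq u (by simp [hu, hu']) with h | h
        · exact ⟨1, by simp, Or.inl ⟨h, by simpa using hsign⟩⟩
        · obtain ⟨q, hq, hflip⟩ := OneWay.exists_phase_xy_flip (hθ u (by simp [hu, hu']))
          exact ⟨q, hq, Or.inr ⟨h, hflip⟩⟩
      · exact ⟨1, by simp, Or.inl ⟨hf.adj_of_xy u (by simp [hu, hu']), by simpa using hsign⟩⟩
    | YZ =>
      have hu := hYZ u u.2 hp
      have hflip := OneWay.measKet_yz_one (θ u)
      by_cases hu' : u.1 ∈ MXY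
      · rcases hf.adj_or_eq u (by simp [hu, hu']) with h | h
        · obtain ⟨q, hq, hsign⟩ := OneWay.exists_phase_yz_sign (hθ u (by simp [hu, hu']))
          exact ⟨q, hq, Or.inl ⟨h, hsign⟩⟩
        · exact ⟨1, by simp, Or.inr ⟨h, by simpa using hflip⟩⟩
      · exact ⟨1, by simp, Or.inr ⟨hf.eq_of_yz u (by simp [hu, hu']), by simpa using hflip⟩⟩
  have hsorted : (OneWay.measurementOrder O).Pairwise (· < ·) := Finset.sortedLT_sort _ |>.pairwise
  obtain ⟨B, hB, hrun⟩ := OneWay.exists_runList G plane θ (fun u => (f u).1)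
    (OneWay.measurementOrder O) (Finset.sort_nodup _ _)
    -- If `u` were `f v` or a neighbour of it, the flow would give `v ≤ u`, against `u < v`.
    (hsorted.imp fun {u v} huv => ⟨fun h => (hle _ _ (hf.prec_apply v)).not_gt (h ▸ huv),
      fun h => (hle _ _ (hf.prec_of_adj v u h.symm)).not_gt huv⟩)
    (fun u _ => hc u) Finset.univ ∅ (fun _ _ => Finset.mem_univ _) (fun _ _ => by simp)
    (OneWay.graphIsometry G I)
    (fun u _ => OneWay.isStabilized_graphIsometry G (Finset.mem_compl.1 (f u).2))
  rw [OneWay.conjTranspose_graphIsometry_mul_self] at hB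
  refine OneWay.performsUnitary_of_isometry (OneWay.remaining_measurementOrder O) hB fun ρ => ?_
  rw [OneWay.procedure, OneWay.entangleGraph_prepare_initial, hrun]
  simp
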